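/- Let $f(\mathbf z,\bar{\mathbf z})=\sum_{\nu,\mu}c_{\nu\mu}\mathbf z^\nu\bar{\mathbf z}^\mu$ be a nonzero mixed polynomial on $\mathbb C^n$. Let $\Gamma_+(f)$ be the convex hull of $\bigcup_{c_{\nu\mu}\neq0}(\nu+\mu+\mathbb R_{\ge 0}^n)$. For a weight $P=(p_1,\dots,p_n)$ with all $p_i\ge 0$, let $\Delta(P)$ be the face of $\Gamma_+(f)$ on which $\xi\mapsto\sum_i p_i\xi_i$ is minimal, and put $I(P)=\{i: p_i=0\}$. Let $\Gamma(f)$ be the union of the compact faces of $\Gamma_+(f)$. For $\Delta\subset\mathbb R^n$ put $f_\Delta=\sum_{\nu+\mu\in\Delta}c_{\nu\mu}\mathbf z^\nu\bar{\mathbf z}^\mu$, and for $I\subset\{1,\dots,n\}$ let $f^I$ be the restriction of $f$ to $\mathbb C^I=\{\mathbf z: z_i=0 \text{ for } i\notin I\}$. The subspace $\mathbb C^I$ is called a vanishing coordinate subspace if $f^I\equiv0$. An essential non-compact face with non-compact direction $I(\Delta)=I$ is a non-compact face $\Delta=\Delta(P)$ with $I(P)=I$ and $f^I\equiv 0$,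 such that $\xi+\mathbb R_{\ge0}E_i\subset\Delta$ for all $\xi\in\Delta$ and $i\in I$, where $E_i$ is the $i$-th unit vector. A critical point of a map to $\mathbb C$ is a point where its real differential is not surjective onto $\mathbb C=\mathbb R^2$. Call $f$ strongly non-degenerate if $f_\Delta:(\mathbb C^*)^n\to\mathbb C$ has no critical point for every compact face $\Delta$ of $\Gamma_+(f)$, and $f_{\Delta\cap\Gamma(f)}:(\mathbb C^*)^n\to\mathbb C$ has no critical point for every essential non-compact face $\Delta$. Call $f$ locally tame along the vanishing coordinate subspaces if for every $I$ with $f^I\equiv0$ and every essential non-compact face $\Delta$ with $I(\Delta)=I$ there is $r_\Delta>0$ such that, for every fixed $(z_j)_{j\in I}\in(\mathbb C^*)^I$ with $\sum_{j\in I}|z_j|^2\le r_\Delta^2$, the function $f_\Delta$ of the remaining variables $(z_k)_{k\notin I}$ has no critical point in $(\mathbb C^*)^{I^c}$. Let $V=f^{-1}(0)$, let $B_r$ be the open ball of radius $r$ about the origin in $\mathbb C^n$ (Euclidean norm), and for $\theta\in\mathbb R$ let $$F_{\theta,\le r}=\{\mathbf z\in B_r\setminus V:\ f(\mathbf z,\bar{\mathbf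 z})/|f(\mathbf z,\bar{\mathbf z})|=e^{i\theta}\}$$ be the fiber over $e^{i\theta}$ of the open ball Milnor map $f/|f|:B_r\setminus V\to S^1$. Suppose that $f$ is strongly non-degenerate and locally tame along the vanishing coordinate subspaces. Then the open ball Milnor fibration of $f$ has the stable boundary property: there is $r_0>0$ such that for every $0<r\le r_0$ and every $\theta\in\mathbb R$, the closure of $F_{\theta,\le r}$ contains $V\cap B_r$. -/

import Mathlib

namespace MixedMilnor

/-- A mixed polynomial `f(z, z̄) = ∑ c_{νμ} z^ν z̄^μ` in `n` complex variables: the variable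
`Sum.inl i` stands for `z_i`, and `Sum.inr i` stands for its conjugate. -/
abbrev MixedPolynomial (n : ℕ) : Type := MvPolynomial (Fin n ⊕ Fin n) ℂ

/-- The value of the mixed polynomial `f` at `z ∈ ℂⁿ`. -/
noncomputable def value {n : ℕ} (f : MixedPolynomial n) (z : Fin n → ℂ) : ℂ :=
  MvPolynomial.eval (Sum.elim z (fun i => (starRingEnd ℂ) (z i))) f

/-- The point `ν + μ ∈ ℝⁿ` attached to the monomial `z^ν z̄^μ`. -/
def totalExponent {n : ℕ} (m : Fin n ⊕ Fin n →₀ ℕ) : Fin n → ℝ :=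
  fun i => (m (Sum.inl i) : ℝ) + (m (Sum.inr i) : ℝ)

/-- The Newton polygon `Γ₊(f)`: the convex hull of the union of the orthants
`ν + μ + ℝ₊ⁿ` over all `(ν, μ)` with `c_{νμ} ≠ 0`. -/
def newtonPolygon {n : ℕ} (f : MixedPolynomial n) : Set (Fin n → ℝ) :=
  convexHull ℝ (⋃ m ∈ f.support, {ξ : Fin n → ℝ | ∀ i, totalExponent m i ≤ ξ i})

/-- The linear function `ℓ_P(ξ) = ∑ p_i ξ_i`. -/
def weightFunction {n : ℕ} (P ξ : Fin n → ℝ) : ℝ := ∑ i, P i * ξ i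

/-- The face `Δ(P)` of `Γ₊(f)` on which `ℓ_P` takes its minimal value. -/
def faceOfWeight {n : ℕ} (f : MixedPolynomial n) (P : Fin n → ℝ) : Set (Fin n → ℝ) :=
  {ξ | ξ ∈ newtonPolygon f ∧ ∀ η ∈ newtonPolygon f, weightFunction P ξ ≤ weightFunction P η}

/-- `Δ` is a compact face of the Newton polygon. -/
def IsCompactFace {n : ℕ} (f : MixedPolynomial n) (Δ : Set (Fin n → ℝ)) : Prop :=
  (∃ P : Fin n → ℝ, (∀ i, 0 ≤ P i) ∧ Δ = faceOfWeight f P) ∧ IsCompact Δ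

/-- The Newton boundary `Γ(f)`: the union of the compact faces of `Γ₊(f)`. -/
def newtonBoundary {n : ℕ} (f : MixedPolynomial n) : Set (Fin n → ℝ) :=
  {ξ | ∃ Δ : Set (Fin n → ℝ), IsCompactFace f Δ ∧ ξ ∈ Δ}

/-- `f^I ≡ 0`: the restriction of `f` to the coordinate subspace
`ℂ^I = {z | z_i = 0 for i ∉ I}` vanishes identically. -/
def VanishesOn {n : ℕ} (f : MixedPolynomial n) (I : Finset (Fin n)) : Prop :=
  ∀ z : Fin n → ℂ, (∀ i, i ∉ I → z i = 0) → value f z = 0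

/-- `Δ` is an essential non-compact face with non-compact direction `I(Δ) = I`. -/
def IsEssentialNoncompactFace {n : ℕ} (f : MixedPolynomial n) (I : Finset (Fin n))
    (Δ : Set (Fin n → ℝ)) : Prop :=
  ∃ P : Fin n → ℝ, (∀ i, 0 ≤ P i) ∧ (∀ i, i ∈ I ↔ P i = 0) ∧
    Δ = faceOfWeight f P ∧ ¬ IsCompact Δ ∧ VanishesOn f I ∧
    ∀ i ∈ I, ∀ ξ ∈ Δ, ∀ t : ℝ, 0 ≤ t → ξ + t • Pi.single i (1 : ℝ) ∈ Δ

open Classical in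
/-- `f_Δ`: the sum of the terms `c_{νμ} z^ν z̄^μ` of `f` with `ν + μ ∈ Δ`. -/
noncomputable def faceFunction {n : ℕ} (f : MixedPolynomial n) (Δ : Set (Fin n → ℝ)) :
    MixedPolynomial n :=
  ∑ m ∈ f.support with totalExponent m ∈ Δ, MvPolynomial.monomial m (f.coeff m)

/-- Critical point of a map to `ℂ = ℝ²` in the real sense: the real differential is not onto. -/
def IsCriticalPoint {E : Type*} [NormedAddCommGroup E] [NormedSpace ℝ E]
    (F : E → ℂ) (z : E) : Prop :=
  ¬ Function.Surjective (fderiv ℝ F z)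

/-- `f : (ℂ*)ⁿ → ℂ` has no critical point. -/
def NoCriticalPointOnTorus {n : ℕ} (f : MixedPolynomial n) : Prop :=
  ∀ z : Fin n → ℂ, (∀ i, z i ≠ 0) → ¬ IsCriticalPoint (value f) z

/-- Strong non-degeneracy. -/
def StronglyNondegenerate {n : ℕ} (f : MixedPolynomial n) : Prop :=
  (∀ Δ, IsCompactFace f Δ → NoCriticalPointOnTorus (faceFunction f Δ)) ∧
  (∀ I Δ, IsEssentialNoncompactFace f I Δ →
    NoCriticalPointOnTorus (faceFunction f (Δ ∩ newtonBoundary f)))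

/-- The point of `ℂⁿ` with coordinates `u` in the directions of `I` and `w` in the others. -/
def glue {n : ℕ} {I : Finset (Fin n)} (u : {i // i ∈ I} → ℂ) (w : {i // i ∉ I} → ℂ) :
    Fin n → ℂ :=
  fun i => if h : i ∈ I then u ⟨i, h⟩ else w ⟨i, h⟩

/-- Local tameness of `f_Δ`, where `I = I(Δ)`: there is `r > 0` such that for every fixed
`u = z_I ∈ (ℂ*)^I` with `ρ_Δ = ∑_{j ∈ I} |z_j|² ≤ r²` the function `f_Δ` of the remaining
variables `w = (z_k)_{k ∉ I}` has no critical point in `(ℂ*)^{I^c}`. -/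
def LocallyTameFace {n : ℕ} (f : MixedPolynomial n) (I : Finset (Fin n))
    (Δ : Set (Fin n → ℝ)) : Prop :=
  ∃ r : ℝ, 0 < r ∧ ∀ u : {i // i ∈ I} → ℂ, (∀ j, u j ≠ 0) → ∑ j, ‖u j‖ ^ 2 ≤ r ^ 2 →
    ∀ w : {i // i ∉ I} → ℂ, (∀ k, w k ≠ 0) →
      ¬ IsCriticalPoint (fun w' : {i // i ∉ I} → ℂ => value (faceFunction f Δ) (glue u w')) w

/-- `f` is locally tame on the vanishing coordinate subspace `ℂ^I`. -/
def LocallyTameOn {n : ℕ} (f : MixedPolynomial n) (I : Finset (Fin n)) : Prop :=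
  ∀ Δ, IsEssentialNoncompactFace f I Δ → LocallyTameFace f I Δ

/-- `f` is locally tame along the vanishing coordinate subspaces. -/
def LocallyTame {n : ℕ} (f : MixedPolynomial n) : Prop :=
  ∀ I : Finset (Fin n), VanishesOn f I → LocallyTameOn f I

/-- The mixed hypersurface `V = f⁻¹(0)`. -/
def zeroSet {n : ℕ} (f : MixedPolynomial n) : Set (EuclideanSpace ℂ (Fin n)) :=
  {z | value f (fun i => z i) = 0}

/-- The fiber `F_{θ,≤r}` over `e^{iθ}` of the open ball Milnor map
`f/|f| : B_r ∖ V → S¹`. -/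
def milnorFiber {n : ℕ} (f : MixedPolynomial n) (r θ : ℝ) : Set (EuclideanSpace ℂ (Fin n)) :=
  {z | z ∈ Metric.ball (0 : EuclideanSpace ℂ (Fin n)) r \ zeroSet f ∧
    value f (fun i => z i) / (‖value f (fun i => z i)‖ : ℂ) = Complex.exp (θ * Complex.I)}

/-- The stable boundary property in the ball `B_r`: the closure of every fiber contains `V`. -/
def StableBoundary {n : ℕ} (f : MixedPolynomial n) (r : ℝ) : Prop :=
  ∀ θ : ℝ, zeroSet f ∩ Metric.ball (0 : EuclideanSpace ℂ (Fin n)) r ⊆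
    closure (milnorFiber f r θ)

end MixedMilnor

/-! It suffices that, for every `a` in `V` close to the origin, `f` takes values on each open ray
`ℝ_{>0} b`, `b ≠ 0`, in every neighbourhood of `a`; then `b = e^{iθ}` gives the theorem. Let `I` be
the set of nonzero coordinates of `a`.

If `f^I` is not identically zero, `f` is a submersion at `a` (`eventually_surjective_fderiv`), hence
open there. Otherwise critical points with support `I` would accumulate at `0`. Along an ultrafilter
of them the dominant monomials are those of a compact face `Δ`, and the rescaled differentials of
`f` tend to that of `f_Δ` at a point of the torus. This limit is onto, and surjectivity is an open
condition. The ultrafilter replaces the curve selection lemma.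

If `f^I ≡ 0`, take an integer weight `p` with zero set `I`, so generic that all terms of the face
function `f_Δ` have the same total exponents outside `I`. Then `G(w) = f_Δ(a_I, w)` is homogeneous
in every radius `|w_k|`. By tameness its image on the torus is open, and it is a cone over a compact
set, so it contains `ℂ*` (`exists_eq_of_not_isCriticalPoint`). Along `(a_I, t^p w)` one has `f = t^d
(G(w) + O(t))`. A regular point `w₀` with `G(w₀) = b` therefore persists for small `t > 0` and
yields the value `t^d b` near `a` (`eventually_exists_value_eq`). -/

namespace MixedMilnor

open Filter Topology

/-! ### Mixed monomials and logarithmic differentials -/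

/-- The mixed monomial `z^ν z̄^μ` with exponent `m = (ν, μ)`. -/
noncomputable def mixedMonomial {n : ℕ} (m : Fin n ⊕ Fin n →₀ ℕ) (z : Fin n → ℂ) : ℂ :=
  ∏ i, z i ^ m (Sum.inl i) * (starRingEnd ℂ) (z i) ^ m (Sum.inr i)

/-- The real linear form `∑ ν_i w_i + μ_i w̄_i`, the logarithmic differential of `z^ν z̄^μ`. -/
noncomputable def logForm {n : ℕ} (m : Fin n ⊕ Fin n →₀ ℕ) (w : Fin n → ℂ) : ℂ :=
  ∑ i, (m (Sum.inl i) * w i + m (Sum.inr i) * (starRingEnd ℂ) (w i))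

theorem eval_monomial_eq {n : ℕ} (m : Fin n ⊕ Fin n →₀ ℕ) (c : ℂ) (z : Fin n → ℂ) :
    value (MvPolynomial.monomial m c) z = c * mixedMonomial m z := by
  rw [value, MvPolynomial.eval_monomial, Finsupp.prod_fintype _ _ (by simp), Fintype.prod_sum_type,
    mixedMonomial, Finset.prod_mul_distrib]
  simp

theorem value_eq_sum {n : ℕ} (f : MixedPolynomial n) (z : Fin n → ℂ) :
    value f z = ∑ m ∈ f.support, f.coeff m * mixedMonomial m z := by
  simp only [← eval_monomial_eq, value]
  rw [← map_sum, ← f.as_sum]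

open Classical in
theorem value_faceFunction {n : ℕ} (f : MixedPolynomial n) (Δ : Set (Fin n → ℝ))
    (z : Fin n → ℂ) :
    value (faceFunction f Δ) z =
      ∑ m ∈ f.support with totalExponent m ∈ Δ, f.coeff m * mixedMonomial m z := by
  simp only [← eval_monomial_eq]
  simp [value, faceFunction]

theorem mixedMonomial_mul {n : ℕ} (m : Fin n ⊕ Fin n →₀ ℕ) (z w : Fin n → ℂ) :
    mixedMonomial m (z * w) = mixedMonomial m z * mixedMonomial m w := by
  simp only [mixedMonomial, ← Finset.prod_mul_distrib]
  refine Finset.prod_congr rfl fun i _ => ?_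
  simp only [Pi.mul_apply, map_mul, mul_pow]
  ring

theorem mixedMonomial_exp {n : ℕ} (m : Fin n ⊕ Fin n →₀ ℕ) (w : Fin n → ℂ) :
    mixedMonomial m (fun i => Complex.exp (w i)) = Complex.exp (logForm m w) := by
  simp only [mixedMonomial, logForm, Complex.exp_sum, Complex.exp_add, Complex.exp_nat_mul,
    Complex.exp_conj]

theorem mixedMonomial_ofReal {n : ℕ} (m : Fin n ⊕ Fin n →₀ ℕ) (x : Fin n → ℝ) :
    mixedMonomial m (fun i => (x i : ℂ)) =
      ((∏ i, x i ^ (m (Sum.inl i) + m (Sum.inr i)) : ℝ) : ℂ) := by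
  simp [mixedMonomial, pow_add]

theorem logForm_ofReal {n : ℕ} (m : Fin n ⊕ Fin n →₀ ℕ) (x : Fin n → ℝ) :
    logForm m (fun i => (x i : ℂ)) = (weightFunction x (totalExponent m) : ℂ) := by
  simp only [logForm, weightFunction, totalExponent, Complex.conj_ofReal]
  push_cast
  exact Finset.sum_congr rfl fun i _ => by ring

theorem logForm_real_smul {n : ℕ} (m : Fin n ⊕ Fin n →₀ ℕ) (s : ℝ) (w : Fin n → ℂ) :
    logForm m (fun i => (s : ℂ) * w i) = s * logForm m w := by
  simp only [logForm, Finset.mul_sum, map_mul, Complex.conj_ofReal]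
  exact Finset.sum_congr rfl fun i _ => by ring

theorem mixedMonomial_exp_ofReal {n : ℕ} (m : Fin n ⊕ Fin n →₀ ℕ) (x : Fin n → ℝ) :
    mixedMonomial m (fun i => ((Real.exp (x i) : ℝ) : ℂ)) =
      (Real.exp (weightFunction x (totalExponent m)) : ℂ) := by
  simp only [Complex.ofReal_exp]
  rw [mixedMonomial_exp m (fun i => (x i : ℂ)), logForm_ofReal]

theorem norm_mixedMonomial {n : ℕ} (m : Fin n ⊕ Fin n →₀ ℕ) (z : Fin n → ℂ) :
    ‖mixedMonomial m z‖ = ∏ i, ‖z i‖ ^ (m (Sum.inl i) + m (Sum.inr i)) := by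
  simp [mixedMonomial, norm_prod, pow_add]

theorem mixedMonomial_eq_zero_of {n : ℕ} {m : Fin n ⊕ Fin n →₀ ℕ} {z : Fin n → ℂ} {i : Fin n}
    (hz : z i = 0) (hm : totalExponent m i ≠ 0) : mixedMonomial m z = 0 := by
  rw [← norm_eq_zero, norm_mixedMonomial]
  refine Finset.prod_eq_zero (Finset.mem_univ i) ?_
  rw [hz, norm_zero, zero_pow]
  rw [totalExponent] at hm
  exact_mod_cast hm

theorem mixedMonomial_congr {n : ℕ} {m : Fin n ⊕ Fin n →₀ ℕ} {z w : Fin n → ℂ}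
    (h : ∀ i, totalExponent m i ≠ 0 → z i = w i) : mixedMonomial m z = mixedMonomial m w := by
  refine Finset.prod_congr rfl fun i _ => ?_
  by_cases hi : totalExponent m i = 0
  · have : m (Sum.inl i) + m (Sum.inr i) = 0 := by
      rw [totalExponent] at hi
      exact_mod_cast hi
    obtain ⟨h1, h2⟩ := Nat.add_eq_zero_iff.1 this
    simp [h1, h2]
  · rw [h i hi]

theorem contDiff_mixedMonomial {n : ℕ} (m : Fin n ⊕ Fin n →₀ ℕ) :
    ContDiff ℝ 1 (mixedMonomial m) := by
  refine contDiff_prod fun i _ => ContDiff.mul ?_ ?_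
  · exact (contDiff_apply ℝ ℂ i).pow _
  · exact (Complex.conjCLE.contDiff.comp (contDiff_apply ℝ ℂ i)).pow _

theorem contDiff_sum_mixedMonomial {n : ℕ} (s : Finset (Fin n ⊕ Fin n →₀ ℕ))
    (c : (Fin n ⊕ Fin n →₀ ℕ) → ℂ) :
    ContDiff ℝ 1 (fun z => ∑ m ∈ s, c m * mixedMonomial m z) :=
  ContDiff.sum fun m _ => contDiff_const.mul (contDiff_mixedMonomial m)

theorem contDiff_value {n : ℕ} (f : MixedPolynomial n) : ContDiff ℝ 1 (value f) := by
  rw [show value f = _ from funext (value_eq_sum f)]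
  exact contDiff_sum_mixedMonomial _ _

/-- The curve `t ↦ a · exp(t w)` has velocity `a w` at `0`, and along it each monomial is a pure
exponential in `t`. In these directions the differential is expressed by the values of the
monomials, whose asymptotics are under control. -/
theorem fderiv_sum_mixedMonomial {n : ℕ} (s : Finset (Fin n ⊕ Fin n →₀ ℕ))
    (c : (Fin n ⊕ Fin n →₀ ℕ) → ℂ) (a w : Fin n → ℂ) :
    fderiv ℝ (fun z => ∑ m ∈ s, c m * mixedMonomial m z) a (a * w) =
      ∑ m ∈ s, c m * (mixedMonomial m a * logForm m w) := by
  have hγ : HasDerivAt (fun t : ℝ => (a * fun i => Complex.exp ((t : ℂ) * w i) : Fin n → ℂ))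
      (a * w) 0 := by
    refine hasDerivAt_pi.2 fun i => ?_
    have h1 : HasDerivAt (fun t : ℝ => (t : ℂ) * w i) (w i) 0 := by
      simpa using (Complex.ofRealCLM.hasDerivAt (x := (0 : ℝ))).mul_const (w i)
    simpa using h1.cexp.const_mul (a i)
  have h0 : (a * fun i => Complex.exp (((0 : ℝ) : ℂ) * w i) : Fin n → ℂ) = a := by
    ext i
    simp
  have hF := ((contDiff_sum_mixedMonomial s c).differentiable (by simp) a).hasFDerivAt
  rw [← h0] at hF
  have h2 := hF.comp_hasDerivAt (0 : ℝ) hγ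
  rw [h0] at h2
  refine h2.unique ?_
  have h3 : ((fun z => ∑ m ∈ s, c m * mixedMonomial m z) ∘
      fun t : ℝ => (a * fun i => Complex.exp ((t : ℂ) * w i) : Fin n → ℂ)) =
      fun t : ℝ => ∑ m ∈ s, c m * (mixedMonomial m a * Complex.exp ((t : ℂ) * logForm m w)) := by
    ext t
    refine Finset.sum_congr rfl fun m _ => ?_
    rw [mixedMonomial_mul, mixedMonomial_exp m fun i => (t : ℂ) * w i, logForm_real_smul]
  rw [h3]
  refine HasDerivAt.fun_sum fun m _ => ?_
  have h1 : HasDerivAt (fun t : ℝ => (t : ℂ) * logForm m w) (logForm m w) 0 := by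
    simpa using (Complex.ofRealCLM.hasDerivAt (x := (0 : ℝ))).mul_const (logForm m w)
  simpa using (h1.cexp.const_mul (mixedMonomial m a)).const_mul (c m)

theorem value_fderiv_mul {n : ℕ} (f : MixedPolynomial n) (a w : Fin n → ℂ) :
    fderiv ℝ (value f) a (a * w) =
      ∑ m ∈ f.support, f.coeff m * (mixedMonomial m a * logForm m w) := by
  rw [show value f = _ from funext (value_eq_sum f), fderiv_sum_mixedMonomial]

open Classical in
theorem faceFunction_fderiv_mul {n : ℕ} (f : MixedPolynomial n) (Δ : Set (Fin n → ℝ))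
    (a w : Fin n → ℂ) :
    fderiv ℝ (value (faceFunction f Δ)) a (a * w) =
      ∑ m ∈ f.support with totalExponent m ∈ Δ, f.coeff m * (mixedMonomial m a * logForm m w) := by
  rw [show value (faceFunction f Δ) = _ from funext (value_faceFunction f Δ),
    fderiv_sum_mixedMonomial]

/-! ### Vanishing on coordinate subspaces; a test for surjectivity -/

/-- Substituting `x + iy` and `x - iy` for `z` and `z̄` gives a polynomial vanishing at all real
points, hence zero; the substitution is invertible over `ℂ`. -/
theorem eq_zero_of_value_eq_zero {n : ℕ} {f : MixedPolynomial n} (h : ∀ z, value f z = 0) :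
    f = 0 := by
  let φ : Fin n ⊕ Fin n → MvPolynomial (Fin n ⊕ Fin n) ℂ := Sum.elim
    (fun i => MvPolynomial.X (Sum.inl i) + MvPolynomial.C Complex.I * MvPolynomial.X (Sum.inr i))
    (fun i => MvPolynomial.X (Sum.inl i) - MvPolynomial.C Complex.I * MvPolynomial.X (Sum.inr i))
  have hev : ∀ x : Fin n ⊕ Fin n → ℂ, MvPolynomial.eval x (MvPolynomial.bind₁ φ f) =
      MvPolynomial.eval (fun j => MvPolynomial.eval x (φ j)) f := by
    intro x
    rw [← MvPolynomial.aeval_eq_eval, MvPolynomial.aeval_bind₁]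
    rfl
  have hg : MvPolynomial.bind₁ φ f = 0 := by
    refine MvPolynomial.funext_set (fun _ => Set.range ((↑) : ℝ → ℂ))
      (fun _ => Set.infinite_range_of_injective Complex.ofReal_injective) fun x hx => ?_
    choose y hy using fun j => hx j (Set.mem_univ j)
    rw [hev, map_zero, ← h fun i => (y (Sum.inl i) : ℂ) + Complex.I * y (Sum.inr i), value]
    congr 2
    ext j
    rcases j with i | i <;> simp [φ, ← hy, sub_eq_add_neg]
  refine MvPolynomial.funext fun x => ?_
  have := hev (Sum.elim (fun i => (x (Sum.inl i) + x (Sum.inr i)) / 2)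
    (fun i => (x (Sum.inl i) - x (Sum.inr i)) / (2 * Complex.I)))
  rw [hg, map_zero] at this
  rw [map_zero, this]
  congr 2
  ext j
  have hI := Complex.I_ne_zero
  rcases j with i | i <;> simp [φ] <;> field_simp <;> ring

/-- Turns `f^I ≡ 0` as a function into a statement on exponents: the terms using only variables in
`I` form a mixed polynomial that vanishes everywhere, so there are none. -/
theorem exists_totalExponent_ne_zero {n : ℕ} {f : MixedPolynomial n} {I : Finset (Fin n)}
    (h : VanishesOn f I) {m : Fin n ⊕ Fin n →₀ ℕ} (hm : m ∈ f.support) :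
    ∃ i, i ∉ I ∧ totalExponent m i ≠ 0 := by
  classical
  by_contra! hcon
  let g : MixedPolynomial n :=
    ∑ m ∈ f.support with ∀ i, i ∉ I → totalExponent m i = 0, MvPolynomial.monomial m (f.coeff m)
  have hg : g = 0 := by
    refine eq_zero_of_value_eq_zero fun z => ?_
    rw [← h (fun i => if i ∈ I then z i else 0) (fun i hi => by simp [hi]), value_eq_sum f]
    have : value g z =
        ∑ m ∈ f.support with ∀ i, i ∉ I → totalExponent m i = 0, f.coeff m * mixedMonomial m z := by
      simp only [← eval_monomial_eq]
      simp [value, g]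
    rw [this, Finset.sum_filter]
    refine Finset.sum_congr rfl fun k _ => ?_
    split_ifs with hk
    · congr 1
      refine mixedMonomial_congr fun i hi => ?_
      rw [if_pos]
      by_contra hiI
      exact hi (hk i hiI)
    · push Not at hk
      obtain ⟨i, hi, hki⟩ := hk
      rw [mixedMonomial_eq_zero_of (i := i) (by simp [hi]) hki, mul_zero]
  have hc : g.coeff m = f.coeff m := by
    simp only [g, MvPolynomial.coeff_sum, MvPolynomial.coeff_monomial]
    rw [Finset.sum_ite_eq', if_pos]
    simpa using ⟨by simpa using hm, hcon⟩
  rw [hg] at hc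
  exact (MvPolynomial.mem_support_iff.1 hm) (by simpa using hc.symm)

theorem exists_mem_support_of_not_vanishesOn {n : ℕ} {f : MixedPolynomial n}
    {I : Finset (Fin n)} (h : ¬ VanishesOn f I) :
    ∃ m ∈ f.support, ∀ i, i ∉ I → totalExponent m i = 0 := by
  by_contra! hcon
  refine h fun z hz => ?_
  rw [value_eq_sum]
  refine Finset.sum_eq_zero fun m hm => ?_
  obtain ⟨i, hi, hmi⟩ := hcon m hm
  rw [mixedMonomial_eq_zero_of (hz i hi) hmi, mul_zero]

/-- The imaginary part is the determinant of `(L v, L w)` in `ℝ²`. It is continuous in the two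
vectors, so surjectivity passes from a limit differential to nearby ones. -/
theorem surjective_of_im_ne_zero {E : Type*} [AddCommGroup E] [Module ℝ E] (L : E →ₗ[ℝ] ℂ)
    {v w : E} (h : ((starRingEnd ℂ) (L v) * L w).im ≠ 0) : Function.Surjective L := by
  intro c
  set D := ((starRingEnd ℂ) (L v) * L w).im with hD
  refine ⟨(((starRingEnd ℂ) c * L w).im / D) • v + (((starRingEnd ℂ) (L v) * c).im / D) • w, ?_⟩
  have hD' : D = (L v).re * (L w).im - (L v).im * (L w).re := by
    rw [hD]
    simp
    ring
  rw [map_add, map_smul, map_smul]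
  apply Complex.ext
  · simp
    field_simp
    rw [hD']
    ring
  · simp
    field_simp
    rw [hD']
    ring

/-! ### The Newton polygon and its faces -/

open scoped Pointwise

theorem newtonPolygon_eq_add {n : ℕ} (f : MixedPolynomial n) :
    newtonPolygon f = convexHull ℝ (totalExponent '' f.support) + {ξ : Fin n → ℝ | 0 ≤ ξ} := by
  have h : (⋃ m ∈ f.support, {ξ : Fin n → ℝ | ∀ i, totalExponent m i ≤ ξ i}) =
      totalExponent '' (f.support : Set (Fin n ⊕ Fin n →₀ ℕ)) + {ξ : Fin n → ℝ | 0 ≤ ξ} := by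
    ext ξ
    simp only [Set.mem_iUnion, Set.mem_ofPred_eq, Set.mem_add, Set.exists_mem_image,
      Finset.mem_coe, exists_prop]
    refine exists_congr fun m => and_congr_right fun _ => ⟨fun h => ?_, ?_⟩
    · exact ⟨ξ - totalExponent m, fun i => sub_nonneg.2 (h i), by simp⟩
    · rintro ⟨η, hη, rfl⟩ i
      simpa using hη i
  have hO : Convex ℝ {ξ : Fin n → ℝ | 0 ≤ ξ} := convex_Ici 0
  rw [newtonPolygon, h, convexHull_add, hO.convexHull_eq]

theorem weightFunction_add {n : ℕ} (P ξ η : Fin n → ℝ) :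
    weightFunction P (ξ + η) = weightFunction P ξ + weightFunction P η := by
  simp [weightFunction, mul_add, Finset.sum_add_distrib]

theorem weightFunction_sub_left {n : ℕ} (P Q ξ : Fin n → ℝ) :
    weightFunction (P - Q) ξ = weightFunction P ξ - weightFunction Q ξ := by
  simp [weightFunction, sub_mul, Finset.sum_sub_distrib]

theorem weightFunction_nonneg {n : ℕ} {P ξ : Fin n → ℝ} (hP : ∀ i, 0 ≤ P i) (hξ : 0 ≤ ξ) :
    0 ≤ weightFunction P ξ :=
  Finset.sum_nonneg fun i _ => mul_nonneg (hP i) (hξ i)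

theorem totalExponent_nonneg {n : ℕ} (m : Fin n ⊕ Fin n →₀ ℕ) : 0 ≤ totalExponent m :=
  fun i => by simp only [totalExponent, Pi.zero_apply]; positivity

theorem totalExponent_mem_newtonPolygon {n : ℕ} {f : MixedPolynomial n}
    {m : Fin n ⊕ Fin n →₀ ℕ} (hm : m ∈ f.support) : totalExponent m ∈ newtonPolygon f :=
  subset_convexHull _ _ (Set.mem_biUnion hm fun _ => le_rfl)

theorem le_weightFunction_of_mem_convexHull {n : ℕ} {f : MixedPolynomial n} {P : Fin n → ℝ}
    {d : ℝ} (hd : ∀ m ∈ f.support, d ≤ weightFunction P (totalExponent m)) {ξ : Fin n → ℝ}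
    (hξ : ξ ∈ convexHull ℝ (totalExponent '' (f.support : Set (Fin n ⊕ Fin n →₀ ℕ)))) :
    d ≤ weightFunction P ξ := by
  have hlin : IsLinearMap ℝ (weightFunction P) :=
    ⟨weightFunction_add P, fun c x => by
      simp only [weightFunction, Pi.smul_apply, smul_eq_mul, Finset.mul_sum]
      exact Finset.sum_congr rfl fun i _ => by ring⟩
  refine convexHull_min ?_ (convex_halfSpace_ge hlin d) hξ
  rintro _ ⟨m, hm, rfl⟩
  exact hd m hm

theorem le_weightFunction_of_mem_newtonPolygon {n : ℕ} {f : MixedPolynomial n} {P : Fin n → ℝ}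
    (hP : ∀ i, 0 ≤ P i) {d : ℝ}
    (hd : ∀ m ∈ f.support, d ≤ weightFunction P (totalExponent m)) {ξ : Fin n → ℝ}
    (hξ : ξ ∈ newtonPolygon f) : d ≤ weightFunction P ξ := by
  rw [newtonPolygon_eq_add] at hξ
  obtain ⟨η, hη, ζ, hζ, rfl⟩ := hξ
  rw [weightFunction_add]
  have := le_weightFunction_of_mem_convexHull hd hη
  have := weightFunction_nonneg hP hζ
  linarith

theorem totalExponent_mem_faceOfWeight_iff {n : ℕ} {f : MixedPolynomial n} {P : Fin n → ℝ}
    (hP : ∀ i, 0 ≤ P i) {m : Fin n ⊕ Fin n →₀ ℕ} (hm : m ∈ f.support) :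
    totalExponent m ∈ faceOfWeight f P ↔ ∀ m' ∈ f.support,
      weightFunction P (totalExponent m) ≤ weightFunction P (totalExponent m') :=
  ⟨fun h _ hm' => h.2 _ (totalExponent_mem_newtonPolygon hm'), fun h =>
    ⟨totalExponent_mem_newtonPolygon hm, fun _ hη =>
      le_weightFunction_of_mem_newtonPolygon hP h hη⟩⟩

theorem exists_totalExponent_mem_faceOfWeight {n : ℕ} {f : MixedPolynomial n} (hf : f ≠ 0)
    {P : Fin n → ℝ} (hP : ∀ i, 0 ≤ P i) :
    ∃ m ∈ f.support, totalExponent m ∈ faceOfWeight f P := by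
  obtain ⟨m, hm, h⟩ := f.support.exists_min_image
    (fun m => weightFunction P (totalExponent m)) (MvPolynomial.support_nonempty.2 hf)
  exact ⟨m, hm, (totalExponent_mem_faceOfWeight_iff hP hm).2 h⟩

/-- When all weights are positive, a minimal point has no orthant component, so the face is a closed
slice of the compact hull of the exponents. -/
theorem isCompactFace_of_pos {n : ℕ} {f : MixedPolynomial n} (hf : f ≠ 0)
    {P : Fin n → ℝ} (hP : ∀ i, 0 < P i) : IsCompactFace f (faceOfWeight f P) := by
  refine ⟨⟨P, fun i => (hP i).le, rfl⟩, ?_⟩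
  obtain ⟨m, hm, hmP⟩ := exists_totalExponent_mem_faceOfWeight hf fun i => (hP i).le
  have hmin := (totalExponent_mem_faceOfWeight_iff (fun i => (hP i).le) hm).1 hmP
  set C := convexHull ℝ (totalExponent '' (f.support : Set (Fin n ⊕ Fin n →₀ ℕ))) with hC
  have hcont : Continuous (weightFunction P) := by
    unfold weightFunction
    fun_prop
  have hcomp : IsCompact C := (f.support.finite_toSet.image _).isCompact_convexHull ℝ
  suffices h : faceOfWeight f P =
      C ∩ {ξ | weightFunction P ξ = weightFunction P (totalExponent m)} by
    rw [h]
    exact hcomp.inter_right (isClosed_eq hcont continuous_const)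
  ext ξ
  constructor
  · rintro ⟨hξ, hξm⟩
    rw [newtonPolygon_eq_add] at hξ
    obtain ⟨η, hη, ζ, hζ, rfl⟩ := hξ
    have h1 := hξm _ (totalExponent_mem_newtonPolygon hm)
    have h2 := le_weightFunction_of_mem_convexHull hmin hη
    have h3 := weightFunction_nonneg (fun i => (hP i).le) hζ
    simp only [weightFunction_add] at h1
    have h4 : weightFunction P ζ = 0 := by linarith
    have h5 : ζ = 0 := by
      ext i
      have := (Finset.sum_eq_zero_iff_of_nonneg
        fun i _ => mul_nonneg (hP i).le (hζ i)).1 h4 i (Finset.mem_univ i)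
      exact (mul_eq_zero.1 this).resolve_left (hP i).ne'
    simp only [h5, add_zero]
    refine ⟨hη, ?_⟩
    simp only [Set.mem_ofPred_eq]
    linarith
  · rintro ⟨hξ, hξm⟩
    refine ⟨?_, fun η hη => ?_⟩
    · rw [newtonPolygon_eq_add]
      exact ⟨ξ, hξ, 0, le_refl (0 : Fin n → ℝ), add_zero ξ⟩
    · rw [show weightFunction P ξ = _ from hξm]
      exact hmP.2 η hη

theorem isEssentialNoncompactFace_faceOfWeight {n : ℕ} {f : MixedPolynomial n} (hf : f ≠ 0)
    {I : Finset (Fin n)} (hI : I.Nonempty) (hv : VanishesOn f I) {P : Fin n → ℝ}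
    (hP : ∀ i, 0 ≤ P i) (hPI : ∀ i, i ∈ I ↔ P i = 0) :
    IsEssentialNoncompactFace f I (faceOfWeight f P) := by
  have hadd : ∀ i ∈ I, ∀ ξ ∈ faceOfWeight f P, ∀ t : ℝ, 0 ≤ t →
      ξ + t • Pi.single i (1 : ℝ) ∈ faceOfWeight f P := by
    rintro i hi ξ ⟨hξ, hξm⟩ t ht
    have h0 : weightFunction P (t • Pi.single i (1 : ℝ)) = 0 := by
      refine Finset.sum_eq_zero fun j _ => ?_
      by_cases hj : j = i
      · rw [hj, (hPI i).1 hi, zero_mul]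
      · simp [hj]
    refine ⟨?_, fun η hη => ?_⟩
    · rw [newtonPolygon_eq_add] at hξ ⊢
      obtain ⟨η, hη, ζ, hζ, rfl⟩ := hξ
      refine ⟨η, hη, ζ + t • Pi.single i (1 : ℝ), ?_, (add_assoc _ _ _).symm⟩
      have h1 : (0 : Fin n → ℝ) ≤ Pi.single i 1 := Pi.single_nonneg.2 zero_le_one
      exact add_nonneg hζ (smul_nonneg ht h1)
    · rw [weightFunction_add, h0, add_zero]
      exact hξm η hη
  refine ⟨P, hP, hPI, rfl, fun hc => ?_, hv, hadd⟩
  obtain ⟨i, hi⟩ := hI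
  obtain ⟨m, -, hm⟩ := exists_totalExponent_mem_faceOfWeight hf hP
  obtain ⟨R, hR⟩ := hc.isBounded.exists_norm_le
  have h1 := hR _ (hadd i hi _ hm (|R| + 1) (by positivity))
  have h2 := norm_le_pi_norm (totalExponent m + (|R| + 1) • Pi.single i (1 : ℝ)) i
  have h3 := totalExponent_nonneg m i
  simp only [Pi.add_apply, Pi.smul_apply, Pi.single_eq_same, smul_eq_mul, mul_one,
    Real.norm_eq_abs] at h2
  have h4 := le_abs_self (totalExponent m i + (|R| + 1))
  have h5 := le_abs_self R
  simp only [Pi.zero_apply] at h3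
  linarith

/-! ### Asymptotic weights along an ultrafilter -/

/-- A generalized inverse: if `A x` converges along a filter, `x` splits into the convergent part `B
(A x)` and a part in the kernel of `A`. -/
theorem exists_linearMap_comp_comp_eq {V W : Type*} [AddCommGroup V] [Module ℝ V]
    [AddCommGroup W] [Module ℝ W] (A : V →ₗ[ℝ] W) :
    ∃ B : W →ₗ[ℝ] V, ∀ x, A (B (A x)) = A x := by
  obtain ⟨g, hg⟩ := A.rangeRestrict.exists_rightInverse_of_surjective A.range_rangeRestrict
  obtain ⟨B, hB⟩ := g.exists_extend
  refine ⟨B, fun x => ?_⟩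
  have h1 : B (A x) = g (A.rangeRestrict x) := by
    rw [← hB]
    rfl
  have h2 : A.rangeRestrict (g (A.rangeRestrict x)) = A.rangeRestrict x :=
    LinearMap.congr_fun hg (A.rangeRestrict x)
  rw [h1]
  exact congrArg Subtype.val h2

/-- Along an ultrafilter on which all weights tend to infinity, the exponents of asymptotically
minimal weight are the exponents on a face of a fixed positive weight `P`. -/
theorem exists_weight_of_ultrafilter {α : Type*} {n : ℕ} (𝒰 : Ultrafilter α)
    (x : α → Fin n → ℝ) (hx : ∀ i, Tendsto (fun a => x a i) 𝒰 atTop)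
    (T : Finset (Fin n → ℝ)) (hT : T.Nonempty) :
    ∃ v₀ ∈ T, ∃ β P : Fin n → ℝ, (∀ i, 0 < P i) ∧ ∀ v ∈ T,
      ((∀ v' ∈ T, weightFunction P v ≤ weightFunction P v') →
        Tendsto (fun a => weightFunction (x a) v - weightFunction (x a) v₀) 𝒰
          (𝓝 (weightFunction β v - weightFunction β v₀))) ∧
      ((¬ ∀ v' ∈ T, weightFunction P v ≤ weightFunction P v') →
        Tendsto (fun a => weightFunction (x a) v - weightFunction (x a) v₀) 𝒰 atTop) := by
  classical
  obtain ⟨v₀, hv₀, hmin⟩ : ∃ v₀ ∈ T, ∀ᶠ a in 𝒰, ∀ v ∈ T,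
      weightFunction (x a) v₀ ≤ weightFunction (x a) v := by
    refine (Ultrafilter.eventually_exists_mem_iff (is := (T : Set (Fin n → ℝ)))
      T.finite_toSet).1 (Eventually.of_forall fun a => ?_)
    exact T.exists_min_image (fun v => weightFunction (x a) v) hT
  set δ : (Fin n → ℝ) → α → ℝ := fun v a => weightFunction (x a) v - weightFunction (x a) v₀
    with hδ
  -- Along an ultrafilter, `δ v` either is eventually bounded above, hence convergent, or tends to
  -- infinity. The bounded `v` will be the face of `P`.
  let Bdd : (Fin n → ℝ) → Prop := fun v => ∃ C, ∀ᶠ a in 𝒰, δ v a ≤ C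
  have hnb : ∀ v, ¬ Bdd v → Tendsto (δ v) 𝒰 atTop := by
    refine fun v hv => tendsto_atTop.2 fun C => ?_
    have h1 : ¬ ∀ᶠ a in 𝒰, δ v a ≤ C := fun h => hv ⟨C, h⟩
    filter_upwards [Ultrafilter.eventually_not.2 h1] with a ha
    exact (not_le.1 ha).le
  have hb : ∀ v ∈ T, Bdd v → ∃ c, Tendsto (δ v) 𝒰 (𝓝 c) := by
    rintro v hv ⟨C, hC⟩
    obtain ⟨c, -, hc⟩ := (isCompact_Icc (a := (0 : ℝ)) (b := C)).ultrafilter_le_nhds'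
      (𝒰.map (δ v)) (by
        change ∀ᶠ a in (𝒰 : Filter α), δ v a ∈ Set.Icc 0 C
        filter_upwards [hC, hmin] with a h1 h2
        exact ⟨sub_nonneg.2 (h2 v hv), h1⟩)
    exact ⟨c, hc⟩
  let ℓ : (Fin n → ℝ) → (Fin n → ℝ) →ₗ[ℝ] ℝ := fun v =>
    { toFun := fun y => weightFunction y v - weightFunction y v₀
      map_add' := fun y z => by
        simp only [weightFunction, Pi.add_apply, add_mul, Finset.sum_add_distrib]
        ring
      map_smul' := fun c y => by
        simp only [weightFunction, Pi.smul_apply, smul_eq_mul, mul_assoc, ← Finset.mul_sum,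
          RingHom.id_apply]
        ring }
  let A : (Fin n → ℝ) →ₗ[ℝ] (T → ℝ) := LinearMap.pi fun v => if Bdd v then ℓ v else 0
  have hA : ∀ y (v : T), Bdd v → A y v = weightFunction y v - weightFunction y v₀ := by
    intro y v hv
    simp only [A, LinearMap.pi_apply, if_pos hv]
    rfl
  obtain ⟨c, hc⟩ : ∃ c : T → ℝ, Tendsto (fun a => A (x a)) 𝒰 (𝓝 c) := by
    have h1 : ∀ v : T, ∃ c, Tendsto (fun a => A (x a) v) 𝒰 (𝓝 c) := by
      intro v
      by_cases hv : Bdd v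
      · obtain ⟨c, hc⟩ := hb v v.2 hv
        exact ⟨c, hc.congr fun a => (hA (x a) v hv).symm⟩
      · refine ⟨0, tendsto_const_nhds.congr fun a => ?_⟩
        simp only [A, LinearMap.pi_apply, if_neg hv]
        rfl
    choose c hc using h1
    exact ⟨c, tendsto_pi_nhds.2 hc⟩
  obtain ⟨B, hB⟩ := exists_linearMap_comp_comp_eq A
  have hBc : Tendsto (fun a => B (A (x a))) 𝒰 (𝓝 (B c)) :=
    (B.continuous_of_finiteDimensional.tendsto c).comp hc
  -- Thus `β = B c` reproduces the limits of all bounded differences.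
  have hABc : A (B c) = c := by
    refine tendsto_nhds_unique ?_ hc
    refine ((A.continuous_of_finiteDimensional.tendsto (B c)).comp hBc).congr fun a => ?_
    exact hB (x a)
  have hδB : ∀ v, Tendsto (fun a => weightFunction (B (A (x a))) v -
      weightFunction (B (A (x a))) v₀) 𝒰 (𝓝 (weightFunction (B c) v - weightFunction (B c) v₀)) :=
    fun v => ((ℓ v).continuous_of_finiteDimensional.tendsto (B c)).comp hBc
  have hpos : ∀ᶠ a in 𝒰, ∀ i, 0 < (x a - B (A (x a))) i := by
    refine eventually_all.2 fun i => ?_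
    have h1 : Tendsto (fun a => x a i + -(B (A (x a)) i)) 𝒰 atTop :=
      (hx i).atTop_add ((tendsto_pi_nhds.1 hBc i).neg)
    filter_upwards [h1.eventually_gt_atTop 0] with a ha
    simpa [sub_eq_add_neg] using ha
  have hgt : ∀ᶠ a in 𝒰, ∀ v ∈ T, ¬ Bdd v →
      weightFunction (x a - B (A (x a))) v₀ < weightFunction (x a - B (A (x a))) v := by
    refine (Finset.eventually_all T).2 fun v _ => ?_
    by_cases hv : Bdd v
    · exact Eventually.of_forall fun _ h => absurd hv h
    · have h1 := (hnb v hv).atTop_add (hδB v).neg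
      filter_upwards [h1.eventually_gt_atTop 0] with a ha _
      rw [weightFunction_sub_left, weightFunction_sub_left]
      simp only [hδ] at ha
      linarith
  -- One sufficiently late `a` supplies `P = x a - B (A (x a))`. It lies in the kernel of `A`, so it
  -- is constant on the bounded exponents; subtracting a convergent term keeps it positive and
  -- larger on the others.
  obtain ⟨a, hapos, hagt⟩ := (hpos.and hgt).exists
  have heq : ∀ v ∈ T, Bdd v →
      weightFunction (x a - B (A (x a))) v = weightFunction (x a - B (A (x a))) v₀ := by
    intro v hv hbv
    have h1 := hA (x a - B (A (x a))) ⟨v, hv⟩ hbv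
    rw [map_sub, hB, sub_self] at h1
    simp only [Pi.zero_apply] at h1
    linarith
  have hv₀B : Bdd v₀ := ⟨0, Eventually.of_forall fun a => by simp [hδ]⟩
  refine ⟨v₀, hv₀, B c, x a - B (A (x a)), hapos, fun v hv => ⟨fun h => ?_, fun h => ?_⟩⟩
  · have hbv : Bdd v := by
      by_contra hbv
      exact absurd (h v₀ hv₀) (not_le.2 (hagt v hv hbv))
    obtain ⟨d, hd⟩ := hb v hv hbv
    rw [← hA (B c) ⟨v, hv⟩ hbv, hABc]
    exact (tendsto_pi_nhds.1 hc ⟨v, hv⟩).congr fun a => hA (x a) ⟨v, hv⟩ hbv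
  · refine hnb v fun hbv => h fun v' hv' => ?_
    rw [heq v hv hbv]
    by_cases hbv' : Bdd v'
    · rw [heq v' hv' hbv']
    · exact (hagt v' hv' hbv').le

/-! ### Regularity of `f` where its restriction does not vanish -/

theorem weightFunction_eq_sum_of_support {n : ℕ} {I : Finset (Fin n)} {v : Fin n → ℝ}
    (hv : ∀ i, i ∉ I → v i = 0) (x : Fin n → ℝ) :
    weightFunction x v = ∑ i ∈ I, x i * v i :=
  (Finset.sum_subset (Finset.subset_univ I) fun i _ hi => by rw [hv i hi, mul_zero]).symm

/-- Near the origin, `f` has no critical points on `(ℂ*)^I` if `f^I` is not identically zero. -/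
theorem eventually_surjective_fderiv {n : ℕ} {f : MixedPolynomial n} (hf : f ≠ 0)
    (hnd : ∀ Δ, IsCompactFace f Δ → NoCriticalPointOnTorus (faceFunction f Δ))
    {I : Finset (Fin n)} (hI : I.Nonempty) (hv : ¬ VanishesOn f I) :
    ∀ᶠ a in 𝓝 (0 : Fin n → ℂ), (∀ i, i ∈ I ↔ a i ≠ 0) →
      Function.Surjective (fderiv ℝ (value f) a) := by
  classical
  by_contra hcon
  have hne := frequently_iff_neBot.1 (not_eventually.1 hcon)
  obtain ⟨𝒰, h𝒰⟩ := @Ultrafilter.exists_le _ _ hne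
  have h0 : Tendsto (fun a : Fin n → ℂ => a) 𝒰 (𝓝 0) := h𝒰.trans inf_le_left
  have hbad : ∀ᶠ a in (𝒰 : Filter (Fin n → ℂ)), (∀ i, i ∈ I ↔ a i ≠ 0) ∧
      ¬ Function.Surjective (fderiv ℝ (value f) a) := by
    have : ∀ᶠ a in (𝒰 : Filter (Fin n → ℂ)), ¬ ((∀ i, i ∈ I ↔ a i ≠ 0) →
      Function.Surjective (fderiv ℝ (value f) a)) := h𝒰 (mem_inf_of_right (mem_principal_self _))
    filter_upwards [this] with a ha
    exact Classical.not_imp.1 ha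
  obtain ⟨m₁, hm₁, hm₁I⟩ := exists_mem_support_of_not_vanishesOn hv
  -- The vanishing coordinates receive the artificial weight `K * σ`. Since `m₁` has weight at most
  -- `(K - 1) * σ`, every monomial using such a coordinate exceeds it by at least `σ`, which tends
  -- to infinity, and so stays off the face.
  set K : ℝ := 1 + ∑ i, totalExponent m₁ i with hK
  have hsum0 : 0 ≤ ∑ i, totalExponent m₁ i := Finset.sum_nonneg fun i _ => totalExponent_nonneg m₁ i
  let σ : (Fin n → ℂ) → ℝ := fun a => ∑ k ∈ I, -Real.log ‖a k‖
  let x : (Fin n → ℂ) → Fin n → ℝ := fun a i => if i ∈ I then -Real.log ‖a i‖ else K * σ a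
  have hlog : ∀ i ∈ I, Tendsto (fun a : Fin n → ℂ => -Real.log ‖a i‖) 𝒰 atTop := by
    intro i hi
    refine tendsto_neg_atBot_atTop.comp (Real.tendsto_log_nhdsNE_zero.comp ?_)
    refine tendsto_nhdsWithin_iff.2 ⟨?_, ?_⟩
    · have := (tendsto_pi_nhds.1 h0 i).norm
      simpa using this
    · filter_upwards [hbad] with a ha
      simpa using (ha.1 i).1 hi
  have hlogpos : ∀ᶠ a in (𝒰 : Filter (Fin n → ℂ)), ∀ i ∈ I, 0 ≤ -Real.log ‖a i‖ :=
    (Finset.eventually_all I).2 fun i hi => (hlog i hi).eventually_ge_atTop 0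
  have hσ : Tendsto σ 𝒰 atTop := by
    obtain ⟨i, hi⟩ := hI
    refine tendsto_atTop_mono' _ ?_ (hlog i hi)
    filter_upwards [hlogpos] with a ha
    exact Finset.single_le_sum (f := fun k => -Real.log ‖a k‖) ha hi
  have hx : ∀ i, Tendsto (fun a => x a i) 𝒰 atTop := by
    intro i
    by_cases hi : i ∈ I
    · simpa only [x, if_pos hi] using hlog i hi
    · simpa only [x, if_neg hi] using hσ.const_mul_atTop (by positivity)
  obtain ⟨v₀, hv₀, β, P, hP, hlim⟩ := exists_weight_of_ultrafilter 𝒰 x hx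
    (f.support.image totalExponent) ((MvPolynomial.support_nonempty.2 hf).image _)
  obtain ⟨m₀, hm₀, rfl⟩ := Finset.mem_image.1 hv₀
  have hΔ : ∀ m ∈ f.support, totalExponent m ∈ faceOfWeight f P ↔
      ∀ v' ∈ f.support.image totalExponent,
        weightFunction P (totalExponent m) ≤ weightFunction P v' := by
    intro m hm
    rw [totalExponent_mem_faceOfWeight_iff (fun i => (hP i).le) hm]
    simp
  set Δ := faceOfWeight f P with hΔdef
  have hΔc := hnd Δ (isCompactFace_of_pos hf hP)
  let u : (Fin n → ℂ) → Fin n → ℂ := fun a i => if i ∈ I then a i / ‖a i‖ else 1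
  obtain ⟨u', hu', hu'lim⟩ := (isCompact_univ_pi fun _ : Fin n =>
    isCompact_sphere (0 : ℂ) 1).ultrafilter_le_nhds' (𝒰.map u) (by
      change ∀ᶠ a in (𝒰 : Filter (Fin n → ℂ)), u a ∈ _
      filter_upwards [hbad] with a ha i _
      by_cases hi : i ∈ I
      · have := (ha.1 i).1 hi
        simp [u, hi, this]
      · simp [u, hi])
  have hu : Tendsto u 𝒰 (𝓝 u') := hu'lim
  -- The limit point on the torus: moduli from `β`, arguments from the limit `u'` of the phases.
  let b : Fin n → ℂ := (fun i => ((Real.exp (-β i) : ℝ) : ℂ)) * u'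
  have hb0 : ∀ i, b i ≠ 0 := by
    intro i
    have : ‖u' i‖ = 1 := by simpa using hu' i (Set.mem_univ i)
    have h1 : u' i ≠ 0 := by
      intro h
      simp [h] at this
    simp only [b, Pi.mul_apply]
    exact mul_ne_zero (by exact_mod_cast (Real.exp_pos _).ne') h1
  have hneg : ∀ (y : Fin n → ℝ) v, weightFunction (fun i => -y i) v = -weightFunction y v := by
    intro y v
    simp [weightFunction]
  have hbm : ∀ m, mixedMonomial m b =
      (Real.exp (-weightFunction β (totalExponent m)) : ℂ) * mixedMonomial m u' := by
    intro m
    simp only [b]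
    rw [mixedMonomial_mul, mixedMonomial_exp_ofReal m fun i => -β i, hneg]
  -- The factor that brings the dominant monomials to size one.
  let e : (Fin n → ℂ) → ℝ := fun a => Real.exp (weightFunction (x a) (totalExponent m₀))
  set e' : ℝ := Real.exp (weightFunction β (totalExponent m₀)) with he'
  have hmono : ∀ m ∈ f.support, Tendsto (fun a => (e a : ℂ) * mixedMonomial m a) 𝒰
      (𝓝 (if totalExponent m ∈ Δ then (e' : ℂ) * mixedMonomial m b else 0)) := by
    intro m hm
    have hmlim := hlim _ (Finset.mem_image_of_mem _ hm)
    rw [← hΔ m hm] at hmlim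
    by_cases hmI : ∀ i, i ∉ I → totalExponent m i = 0
    · have hmu : Tendsto (fun a => mixedMonomial m (u a)) 𝒰 (𝓝 (mixedMonomial m u')) :=
        ((contDiff_mixedMonomial m).continuous.tendsto u').comp hu
      have hev : ∀ᶠ a in (𝒰 : Filter (Fin n → ℂ)),
          (Real.exp (-(weightFunction (x a) (totalExponent m) -
            weightFunction (x a) (totalExponent m₀))) : ℂ) * mixedMonomial m (u a) =
          (e a : ℂ) * mixedMonomial m a := by
        filter_upwards [hbad] with a ha
        have h1 : mixedMonomial m a =
            mixedMonomial m ((fun i => ((Real.exp (-x a i) : ℝ) : ℂ)) * u a) := by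
          refine mixedMonomial_congr fun i hi => ?_
          have hiI : i ∈ I := by
            by_contra h
            exact hi (hmI i h)
          have h2 : a i ≠ 0 := (ha.1 i).1 hiI
          have h3 : (0 : ℝ) < ‖a i‖ := norm_pos_iff.2 h2
          simp only [x, u, if_pos hiI, Pi.mul_apply, neg_neg, Real.exp_log h3]
          have h4 : (‖a i‖ : ℂ) ≠ 0 := by exact_mod_cast h3.ne'
          field_simp
        rw [h1, mixedMonomial_mul, mixedMonomial_exp_ofReal m fun i => -x a i, hneg, neg_sub,
          sub_eq_add_neg, Real.exp_add, Complex.ofReal_mul, mul_assoc]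
      refine Tendsto.congr' hev ?_
      split_ifs with hmΔ
      · have h1 := (Complex.continuous_ofReal.tendsto _).comp
          ((Real.continuous_exp.tendsto _).comp (hmlim.1 hmΔ).neg)
        have h2 := h1.mul hmu
        rw [hbm, he', ← mul_assoc, ← Complex.ofReal_mul, ← Real.exp_add, ← sub_eq_add_neg,
          ← neg_sub]
        exact h2
      · have h1 := (Complex.continuous_ofReal.tendsto _).comp
          (Real.tendsto_exp_atBot.comp (tendsto_neg_atTop_atBot.comp (hmlim.2 hmΔ)))
        have h2 := h1.mul hmu
        rw [Complex.ofReal_zero, zero_mul] at h2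
        exact h2
    · push Not at hmI
      obtain ⟨k, hkI, hk⟩ := hmI
      have htop : Tendsto (fun a => weightFunction (x a) (totalExponent m) -
          weightFunction (x a) (totalExponent m₁)) 𝒰 atTop := by
        refine tendsto_atTop_mono' _ ?_ hσ
        filter_upwards [hlogpos] with a ha
        have hσ0 : 0 ≤ σ a := Finset.sum_nonneg ha
        have hx0 : ∀ i, 0 ≤ x a i := by
          intro i
          by_cases hi : i ∈ I
          · simpa only [x, if_pos hi] using ha i hi
          · simp only [x, if_neg hi]
            positivity
        have h1 : K * σ a ≤ weightFunction (x a) (totalExponent m) := by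
          have h2 : x a k * totalExponent m k ≤ weightFunction (x a) (totalExponent m) :=
            Finset.single_le_sum (f := fun i => x a i * totalExponent m i)
              (fun i _ => mul_nonneg (hx0 i) (totalExponent_nonneg m i)) (Finset.mem_univ k)
          have h3 : 1 ≤ totalExponent m k := by
            simp only [totalExponent] at hk ⊢
            have : m (Sum.inl k) + m (Sum.inr k) ≠ 0 := by exact_mod_cast hk
            exact_mod_cast Nat.one_le_iff_ne_zero.2 this
          have h4 : x a k = K * σ a := by simp only [x, if_neg hkI]
          have h5 := mul_le_mul_of_nonneg_left h3 (hx0 k)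
          linarith
        have h2 : weightFunction (x a) (totalExponent m₁) ≤ (K - 1) * σ a := by
          rw [weightFunction_eq_sum_of_support hm₁I, Finset.mul_sum]
          refine Finset.sum_le_sum fun i hi => ?_
          simp only [x, if_pos hi]
          rw [mul_comm]
          refine mul_le_mul_of_nonneg_right ?_ (ha i hi)
          rw [hK, add_sub_cancel_left]
          exact Finset.single_le_sum (f := fun i => totalExponent m₁ i)
            (fun i _ => totalExponent_nonneg m₁ i) (Finset.mem_univ i)
        linarith
      have hmΔ : totalExponent m ∉ Δ := by
        intro hmΔ
        have h1 : Tendsto (fun a => (weightFunction (x a) (totalExponent m) -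
            weightFunction (x a) (totalExponent m₁)) + (weightFunction (x a) (totalExponent m₁) -
            weightFunction (x a) (totalExponent m₀))) 𝒰 atTop := by
          have hm₁lim := hlim _ (Finset.mem_image_of_mem _ hm₁)
          rw [← hΔ m₁ hm₁] at hm₁lim
          by_cases h : totalExponent m₁ ∈ Δ
          · exact htop.atTop_add (hm₁lim.1 h)
          · exact htop.atTop_add_atTop (hm₁lim.2 h)
        simp only [sub_add_sub_cancel] at h1
        exact not_tendsto_nhds_of_tendsto_atTop h1 _ (hmlim.1 hmΔ)
      rw [if_neg hmΔ]
      refine tendsto_const_nhds.congr' ?_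
      filter_upwards [hbad] with a ha
      have : a k = 0 := by
        by_contra h
        exact hkI ((ha.1 k).2 h)
      rw [mixedMonomial_eq_zero_of this hk, mul_zero]
  have hder : ∀ w, Tendsto (fun a => fderiv ℝ (value f) a ((e a) • (a * w))) 𝒰
      (𝓝 (fderiv ℝ (value (faceFunction f Δ)) b (e' • (b * w)))) := by
    intro w
    have h1 : ∀ a : Fin n → ℂ, fderiv ℝ (value f) a ((e a) • (a * w)) =
        ∑ m ∈ f.support, f.coeff m * (((e a : ℂ) * mixedMonomial m a) * logForm m w) := by
      intro a
      rw [map_smul, value_fderiv_mul, Complex.real_smul, Finset.mul_sum]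
      exact Finset.sum_congr rfl fun m _ => by ring
    have h2 : fderiv ℝ (value (faceFunction f Δ)) b (e' • (b * w)) =
        ∑ m ∈ f.support, f.coeff m *
          ((if totalExponent m ∈ Δ then (e' : ℂ) * mixedMonomial m b else 0) * logForm m w) := by
      rw [map_smul, faceFunction_fderiv_mul, Complex.real_smul, Finset.mul_sum, Finset.sum_filter]
      refine Finset.sum_congr rfl fun m _ => ?_
      split_ifs <;> ring
    simp only [h1]
    rw [h2]
    exact tendsto_finsetSum _ fun m hm =>
      ((hmono m hm).mul_const _).const_mul _
  have hsurj := not_not.1 (hΔc b hb0)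
  have hw : ∀ c : ℂ, ∃ w, fderiv ℝ (value (faceFunction f Δ)) b (e' • (b * w)) = c := by
    intro c
    obtain ⟨v, hv⟩ := hsurj (e'⁻¹ • c)
    refine ⟨v / b, ?_⟩
    have : b * (v / b) = v := by
      ext i
      simp only [Pi.mul_apply, Pi.div_apply]
      rw [mul_div_cancel₀ _ (hb0 i)]
    rw [this, map_smul, hv, smul_smul, mul_inv_cancel₀ (Real.exp_pos _).ne', one_smul]
  obtain ⟨w₁, hw₁⟩ := hw 1
  obtain ⟨w₂, hw₂⟩ := hw Complex.I
  have hD := (Complex.continuous_im.tendsto _).comp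
    (((Complex.continuous_conj.tendsto _).comp (hder w₁)).mul (hder w₂))
  rw [hw₁, hw₂] at hD
  have hne0 : ((starRingEnd ℂ) 1 * Complex.I).im ≠ 0 := by simp
  obtain ⟨a, ha1, ha2⟩ := ((hD.eventually_ne hne0).and hbad).exists
  exact ha2.2 (surjective_of_im_ne_zero (fderiv ℝ (value f) a).toLinearMap ha1)

/-! ### Generic weights and open cones -/

/-- The total degree of `z^ν z̄^μ` for the integer weight `p`. -/
def weightedDegree {n : ℕ} (p : Fin n → ℕ) (m : Fin n ⊕ Fin n →₀ ℕ) : ℕ :=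
  ∑ i, p i * (m (Sum.inl i) + m (Sum.inr i))

theorem weightFunction_natCast {n : ℕ} (p : Fin n → ℕ) (m : Fin n ⊕ Fin n →₀ ℕ) :
    weightFunction (fun i => (p i : ℝ)) (totalExponent m) = weightedDegree p m := by
  simp [weightFunction, totalExponent, weightedDegree]

/-- A weight with prescribed zero set which separates the exponents of finitely many monomials
outside this zero set. -/
theorem exists_generic_weight {n : ℕ} (T : Finset (Fin n ⊕ Fin n →₀ ℕ)) (I : Finset (Fin n)) :
    ∃ p : Fin n → ℕ, (∀ i, i ∈ I ↔ p i = 0) ∧ ∀ m ∈ T, ∀ m' ∈ T,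
      weightedDegree p m = weightedDegree p m' → ∀ i, i ∉ I →
        m (Sum.inl i) + m (Sum.inr i) = m' (Sum.inl i) + m' (Sum.inr i) := by
  classical
  let e : (Fin n ⊕ Fin n →₀ ℕ) → Fin n → ℕ := fun m i => m (Sum.inl i) + m (Sum.inr i)
  let Q : (Fin n ⊕ Fin n →₀ ℕ) × (Fin n ⊕ Fin n →₀ ℕ) → Polynomial ℤ := fun q =>
    ∑ i, if i ∈ I then 0 else Polynomial.monomial (i : ℕ) ((e q.1 i : ℤ) - e q.2 i)
  have hcoeff : ∀ q i, i ∉ I → (Q q).coeff (i : ℕ) = (e q.1 i : ℤ) - e q.2 i := by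
    intro q i hi
    simp only [Q, Polynomial.finsetSum_coeff]
    rw [Finset.sum_eq_single i]
    · rw [if_neg hi, Polynomial.coeff_monomial_same]
    · intro j _ hj
      split_ifs
      · simp
      · rw [Polynomial.coeff_monomial_of_ne]
        exact fun h => hj (Fin.ext h.symm)
    · simp
  -- With `p i = s ^ i` off `I`, two weighted degrees agree exactly when `s` is a root of `Q`.
  -- Avoiding the roots of the nonzero `Q` forces `Q = 0`, that is, equal exponents; `s = t + 1`
  -- keeps these weights nonzero.
  let bad : Finset ℤ := (T ×ˢ T).biUnion fun q => (Q q).roots.toFinset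
  obtain ⟨_, ⟨t, rfl⟩, ht⟩ := (Set.infinite_range_of_injective
    (f := fun t : ℕ => ((t + 1 : ℕ) : ℤ)) fun a b h => by simpa using h).exists_notMem_finset bad
  have hp : ∀ q : (Fin n ⊕ Fin n →₀ ℕ) × (Fin n ⊕ Fin n →₀ ℕ),
      (Q q).eval (((t + 1 : ℕ) : ℤ)) =
        (weightedDegree (fun i => if i ∈ I then 0 else (t + 1) ^ (i : ℕ)) q.1 : ℤ) -
        weightedDegree (fun i => if i ∈ I then 0 else (t + 1) ^ (i : ℕ)) q.2 := by
    intro q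
    simp only [Q, Polynomial.eval_finsetSum, weightedDegree, Nat.cast_sum,
      ← Finset.sum_sub_distrib]
    refine Finset.sum_congr rfl fun i _ => ?_
    split_ifs
    · simp
    · simp only [Polynomial.eval_monomial, e]
      push_cast
      ring
  refine ⟨fun i => if i ∈ I then 0 else (t + 1) ^ (i : ℕ), fun i => ?_, ?_⟩
  · by_cases hi : i ∈ I <;> simp [hi]
  · intro m hm m' hm' h i hi
    have h0 : Q (m, m') = 0 := by
      by_contra hne
      refine ht (Finset.mem_biUnion.2 ⟨(m, m'), Finset.mk_mem_product hm hm', ?_⟩)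
      rw [Multiset.mem_toFinset, Polynomial.mem_roots hne, Polynomial.IsRoot, hp, h, sub_self]
    have h1 := hcoeff (m, m') i hi
    rw [h0, Polynomial.coeff_zero] at h1
    simp only [e] at h1
    omega

/-- An open cone over a compact set in the plane contains all nonzero vectors. -/
theorem mem_of_isOpen_cone {U K : Set ℂ} (hU : IsOpen U) (hK : IsCompact K) (hne : K.Nonempty)
    (hUK : ∀ z, z ∈ U ↔ ∃ s : ℝ, 0 < s ∧ ∃ v ∈ K, z = s * v) {c : ℂ} (hc : c ≠ 0) : c ∈ U := by
  -- If `0 ∈ K`, the cone is a neighbourhood of `0` and scaling suffices. Otherwise its directions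
  -- form a compact set, so it is open and relatively closed in the connected set `ℂ ∖ {0}`.
  by_cases h0 : (0 : ℂ) ∈ K
  · have hU0 : (0 : ℂ) ∈ U := (hUK 0).2 ⟨1, one_pos, 0, h0, by simp⟩
    have hlim : Tendsto (fun ε : ℝ => (ε : ℂ) * c) (𝓝[>] 0) (𝓝 0) := by
      have h1 : Continuous fun ε : ℝ => (ε : ℂ) * c := by fun_prop
      simpa using (h1.tendsto 0).mono_left nhdsWithin_le_nhds
    obtain ⟨ε, hε, hεpos⟩ :=
      ((hlim.eventually (hU.mem_nhds hU0)).and self_mem_nhdsWithin).exists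
    obtain ⟨s, hs, v, hv, hsv⟩ := (hUK _).1 hε
    have hεpos' : (0 : ℝ) < ε := hεpos
    refine (hUK c).2 ⟨s / ε, div_pos hs hεpos', v, hv, ?_⟩
    have h2 : (ε : ℂ) ≠ 0 := by exact_mod_cast hεpos'.ne'
    push_cast
    field_simp
    rw [mul_comm, hsv]
  · have hcont : ContinuousOn (fun z : ℂ => z / (‖z‖ : ℂ)) {0}ᶜ := by
      refine continuousOn_id.div (by fun_prop) fun z hz => ?_
      simpa using hz
    have hK' : IsClosed ((fun z : ℂ => z / (‖z‖ : ℂ)) '' K) :=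
      (hK.image_of_continuousOn (hcont.mono fun z hz h => h0 (by
        rw [← (show z = 0 from h)]; exact hz))).isClosed
    have hdir : ∀ s : ℝ, 0 < s → ∀ v : ℂ, (s * v) / (‖(s : ℂ) * v‖ : ℂ) = v / (‖v‖ : ℂ) := by
      intro s hs v
      have h1 : (s : ℂ) ≠ 0 := by exact_mod_cast hs.ne'
      rw [norm_mul, Complex.norm_real, Real.norm_of_nonneg hs.le, Complex.ofReal_mul,
        mul_div_mul_left _ _ h1]
    have hconn : IsPreconnected ({0}ᶜ : Set ℂ) :=
      (isConnected_compl_singleton_of_one_lt_rank (by simp) 0).isPreconnected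
    refine hconn.subset_of_closure_inter_subset hU ?_ ?_ hc
    · obtain ⟨v, hv⟩ := hne
      exact ⟨v, fun h => h0 (by rw [← (show v = 0 from h)]; exact hv),
        (hUK v).2 ⟨1, one_pos, v, hv, by simp⟩⟩
    · rintro z ⟨hz, hz0⟩
      have hz0' : z ≠ 0 := hz0
      have hmem : z / (‖z‖ : ℂ) ∈ (fun z : ℂ => z / (‖z‖ : ℂ)) '' K := by
        by_contra hcon
        have hat := hcont.continuousAt (isOpen_compl_singleton.mem_nhds hz0)
        have h1 := hat.eventually (hK'.isOpen_compl.mem_nhds hcon)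
        obtain ⟨y, hy, hyU⟩ := ((mem_closure_iff_frequently.1 hz).and_eventually h1).exists
        obtain ⟨s, hs, v, hv, rfl⟩ := (hUK y).1 hy
        exact hyU ⟨v, hv, (hdir s hs v).symm⟩
      obtain ⟨v, hv, hvz⟩ := hmem
      have hv0 : v ≠ 0 := fun h => h0 (h ▸ hv)
      have h1 : (0 : ℝ) < ‖z‖ := norm_pos_iff.2 hz0'
      have h2 : (0 : ℝ) < ‖v‖ := norm_pos_iff.2 hv0
      refine (hUK z).2 ⟨‖z‖ / ‖v‖, div_pos h1 h2, v, hv, ?_⟩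
      have h3 : (‖z‖ : ℂ) ≠ 0 := by exact_mod_cast h1.ne'
      have h4 : (‖v‖ : ℂ) ≠ 0 := by exact_mod_cast h2.ne'
      simp only at hvz
      rw [eq_comm, div_eq_iff h3] at hvz
      refine hvz.trans ?_
      push_cast
      ring

/-! ### Values of `f` near vanishing coordinate subspaces -/

theorem contDiff_glue {n : ℕ} {I : Finset (Fin n)} (u : {i // i ∈ I} → ℂ) :
    ContDiff ℝ 1 (glue u) := by
  refine contDiff_pi.2 fun i => ?_
  by_cases h : i ∈ I
  · simp only [glue, dif_pos h]
    exact contDiff_const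
  · simp only [glue, dif_neg h]
    exact contDiff_apply ℝ ℂ _

theorem glue_mul_glue {n : ℕ} {I : Finset (Fin n)} (u u' : {i // i ∈ I} → ℂ)
    (w w' : {i // i ∉ I} → ℂ) : glue (u * u') (w * w') = glue u w * glue u' w' := by
  ext i
  by_cases h : i ∈ I <;> simp [glue, h]

/-- The regularity of the face functions on vanishing coordinate subspaces near the origin. -/
theorem eventually_not_isCriticalPoint {n : ℕ} {f : MixedPolynomial n} (hf : f ≠ 0)
    (hnd : ∀ Δ, IsCompactFace f Δ → NoCriticalPointOnTorus (faceFunction f Δ))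
    (htame : LocallyTame f) {I : Finset (Fin n)} (hv : VanishesOn f I) {P : Fin n → ℝ}
    (hP : ∀ i, 0 ≤ P i) (hPI : ∀ i, i ∈ I ↔ P i = 0) :
    ∀ᶠ a in 𝓝 (0 : Fin n → ℂ), (∀ i ∈ I, a i ≠ 0) → ∀ w : {i // i ∉ I} → ℂ, (∀ k, w k ≠ 0) →
      ¬ IsCriticalPoint (fun w' : {i // i ∉ I} → ℂ =>
        value (faceFunction f (faceOfWeight f P)) (glue (fun j => a j) w')) w := by
  -- For empty `I` the weight is positive and the face compact, so non-degeneracy on compact faces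
  -- takes the place of tameness.
  rcases I.eq_empty_or_nonempty with rfl | hI
  · refine Eventually.of_forall fun a _ w hw => ?_
    have hreg := hnd _ (isCompactFace_of_pos hf fun i =>
      (hP i).lt_of_ne fun h => by simpa using (hPI i).2 h.symm)
    let L : ({i : Fin n // i ∉ (∅ : Finset (Fin n))} → ℂ) →L[ℝ] (Fin n → ℂ) :=
      ContinuousLinearMap.pi fun i => ContinuousLinearMap.proj ⟨i, by simp⟩
    have hL : (fun w' => value (faceFunction f (faceOfWeight f P))
        (glue (fun j : {i // i ∈ (∅ : Finset (Fin n))} => a j) w')) =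
        value (faceFunction f (faceOfWeight f P)) ∘ L := by
      ext w'
      simp only [Function.comp_apply]
      congr 1
    have hLw : ∀ i, L w i ≠ 0 := fun i => hw _
    have hd := ((contDiff_value (faceFunction f (faceOfWeight f P))).differentiable
      (by simp) (L w)).hasFDerivAt.comp w L.hasFDerivAt
    have hs := not_not.1 (hreg (L w) hLw)
    rw [IsCriticalPoint, not_not, hL, hd.fderiv]
    refine hs.comp fun v => ⟨fun k => v k, ?_⟩
    ext i
    rfl
  · obtain ⟨r, hr, h⟩ := htame I hv _ (isEssentialNoncompactFace_faceOfWeight hf hI hv hP hPI)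
    have hcont : Continuous fun a : Fin n → ℂ => ∑ j : {i // i ∈ I}, ‖a j‖ ^ 2 := by fun_prop
    have hlim := hcont.tendsto 0
    simp only [Pi.zero_apply, norm_zero, ne_eq, OfNat.ofNat_ne_zero, not_false_eq_true, zero_pow,
      Finset.sum_const_zero] at hlim
    filter_upwards [hlim.eventually_le_const (show 0 < r ^ 2 by positivity)] with a ha haI w hw
    exact h (fun j => a j) (fun j => haI j j.2) ha w hw

/-- On real points `ν` and `μ` enter only through `ν + μ`; hence a common radial factor can be
pulled out of the face function. -/
theorem mixedMonomial_glue_one_ofReal {n : ℕ} {I : Finset (Fin n)}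
    {m m' : Fin n ⊕ Fin n →₀ ℕ} (h : ∀ i, i ∉ I →
      m (Sum.inl i) + m (Sum.inr i) = m' (Sum.inl i) + m' (Sum.inr i))
    (x : {i // i ∉ I} → ℝ) :
    mixedMonomial m (glue 1 fun k => (x k : ℂ)) = mixedMonomial m' (glue 1 fun k => (x k : ℂ)) := by
  have h1 : (glue 1 fun k => (x k : ℂ)) =
      fun i => (((if h : i ∈ I then 1 else x ⟨i, h⟩ : ℝ) : ℝ) : ℂ) := by
    ext i
    by_cases hi : i ∈ I <;> simp [glue, hi]
  rw [h1, mixedMonomial_ofReal, mixedMonomial_ofReal]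
  congr 1
  refine Finset.prod_congr rfl fun i _ => ?_
  by_cases hi : i ∈ I
  · simp [hi]
  · rw [h i hi]

/-- If all terms of `∑ c_m z^ν z̄^μ` have the same total exponents outside `I` and the same
positive weighted degree, and the sum has no critical points on the torus `(ℂ*)^{I^c}` over
`u ∈ (ℂ*)^I`, then it takes there every nonzero value. -/
theorem exists_eq_of_not_isCriticalPoint {n : ℕ} {I : Finset (Fin n)}
    {S : Finset (Fin n ⊕ Fin n →₀ ℕ)} (c : (Fin n ⊕ Fin n →₀ ℕ) → ℂ) {p : Fin n → ℕ} {d : ℕ}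
    (hd : d ≠ 0) (hp : ∀ i ∈ I, p i = 0) (hS : ∀ m ∈ S, weightedDegree p m = d)
    {m₀ : Fin n ⊕ Fin n →₀ ℕ} (hm₀ : ∀ m ∈ S, ∀ i, i ∉ I →
      m (Sum.inl i) + m (Sum.inr i) = m₀ (Sum.inl i) + m₀ (Sum.inr i))
    (u : {i // i ∈ I} → ℂ)
    (hreg : ∀ w : {i // i ∉ I} → ℂ, (∀ k, w k ≠ 0) →
      ¬ IsCriticalPoint (fun w' => ∑ m ∈ S, c m * mixedMonomial m (glue u w')) w)
    {b : ℂ} (hb : b ≠ 0) :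
    ∃ w : {i // i ∉ I} → ℂ, (∀ k, w k ≠ 0) ∧ ∑ m ∈ S, c m * mixedMonomial m (glue u w) = b := by
  set G : ({i // i ∉ I} → ℂ) → ℂ := fun w' => ∑ m ∈ S, c m * mixedMonomial m (glue u w') with hG
  have hGc : ContDiff ℝ 1 G := (contDiff_sum_mixedMonomial S c).comp (contDiff_glue u)
  have hopen : IsOpen (G '' {w | ∀ k, w k ≠ 0}) := by
    rw [isOpen_iff_mem_nhds]
    rintro _ ⟨w, hw, rfl⟩
    have hs := hGc.contDiffAt.hasStrictFDerivAt (x := w) (by simp)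
    rw [← hs.map_nhds_eq_of_surj (LinearMap.range_eq_top.2 (not_not.1 (hreg w hw)))]
    refine image_mem_map ?_
    exact eventually_all.2 fun k => (continuous_apply k).continuousAt.eventually_ne (hw k)
  have hcomp : IsCompact (G '' {w | ∀ k, ‖w k‖ = 1}) := by
    refine IsCompact.image ?_ hGc.continuous
    convert! isCompact_univ_pi fun _ : {i // i ∉ I} => isCompact_sphere (0 : ℂ) 1 using 1
    ext w
    simp
  have hne : (G '' {w | ∀ k, ‖w k‖ = 1}).Nonempty := ⟨_, 1, by simp, rfl⟩
  refine mem_of_isOpen_cone hopen hcomp hne (fun z => ⟨?_, ?_⟩) hb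
  · rintro ⟨w, hw, rfl⟩
    -- All terms scale by the same `ρ` when the radii are normalized to `1`, so `G(w) = ρ G(w/|w|)`.
    set ρ : ℝ := ∏ i, (if h : i ∈ I then 1 else ‖w ⟨i, h⟩‖ : ℝ) ^
      (m₀ (Sum.inl i) + m₀ (Sum.inr i)) with hρ
    refine ⟨ρ, ?_, _, ⟨fun k => w k / (‖w k‖ : ℂ), fun k => ?_, rfl⟩, ?_⟩
    · refine Finset.prod_pos fun i _ => pow_pos ?_ _
      split_ifs
      · exact one_pos
      · exact norm_pos_iff.2 (hw _)
    · have := hw k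
      simp [this]
    · have h1 : glue u w = glue 1 (fun k => (‖w k‖ : ℂ)) * glue u fun k => w k / (‖w k‖ : ℂ) := by
        rw [← glue_mul_glue, one_mul]
        congr 1
        ext k
        have : (‖w k‖ : ℂ) ≠ 0 := by simpa using hw k
        simp only [Pi.mul_apply]
        field_simp
      have h2 : mixedMonomial m₀ (glue (I := I) 1 fun k => (‖w k‖ : ℂ)) = ρ := by
        rw [hρ, ← mixedMonomial_ofReal]
        refine mixedMonomial_congr fun i _ => ?_
        by_cases hi : i ∈ I <;> simp [glue, hi]
      simp only [hG, h1, Finset.mul_sum]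
      refine Finset.sum_congr rfl fun m hm => ?_
      rw [mixedMonomial_mul, mixedMonomial_glue_one_ofReal (hm₀ m hm) fun k => ‖w k‖, h2]
      ring
  · rintro ⟨s, hs, _, ⟨w, hw, rfl⟩, rfl⟩
    -- Scaling `w_k` by `s^{p_k/d}` multiplies `G` by `s`; as `p = 0` on `I`, `u` is unchanged.
    set y : Fin n → ℝ := fun i => Real.log s / d * p i with hy
    refine ⟨fun k => (Real.exp (y k) : ℂ) * w k, fun k => ?_, ?_⟩
    · refine mul_ne_zero (by exact_mod_cast (Real.exp_pos _).ne') fun h => ?_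
      have := hw k
      simp [h] at this
    · have h1 : (glue u fun k => (Real.exp (y k) : ℂ) * w k) =
          (fun i => ((Real.exp (y i) : ℝ) : ℂ)) * glue u w := by
        ext i
        by_cases hi : i ∈ I
        · simp [glue, hi, hy, hp i hi]
        · simp [glue, hi]
      simp only [hG, h1, Finset.mul_sum]
      refine Finset.sum_congr rfl fun m hm => ?_
      have h2 : weightFunction y (totalExponent m) = Real.log s := by
        have h3 : weightFunction y (totalExponent m) =
            Real.log s / d * weightFunction (fun i => (p i : ℝ)) (totalExponent m) := by
          simp only [weightFunction, hy, Finset.mul_sum]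
          exact Finset.sum_congr rfl fun i _ => by ring
        rw [h3, weightFunction_natCast, hS m hm]
        have : (d : ℝ) ≠ 0 := by exact_mod_cast hd
        field_simp
      rw [mixedMonomial_mul, mixedMonomial_exp_ofReal, h2, Real.exp_log hs]
      ring

theorem mixedMonomial_natPow {n : ℕ} (m : Fin n ⊕ Fin n →₀ ℕ) (p : Fin n → ℕ) (t : ℝ) :
    mixedMonomial m (fun i => (t : ℂ) ^ p i) = (t : ℂ) ^ weightedDegree p m := by
  have := mixedMonomial_ofReal m fun i => t ^ p i
  simp only [Complex.ofReal_pow] at this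
  rw [this, weightedDegree, ← Finset.prod_pow_eq_pow_sum]
  push_cast
  exact Finset.prod_congr rfl fun i _ => by rw [pow_mul]

/-- Near a point close to the origin of a vanishing coordinate subspace, `f` takes values on
every open ray. -/
theorem eventually_exists_value_eq {n : ℕ} {f : MixedPolynomial n} (hf : f ≠ 0)
    (hnd : ∀ Δ, IsCompactFace f Δ → NoCriticalPointOnTorus (faceFunction f Δ))
    (htame : LocallyTame f) {I : Finset (Fin n)} (hv : VanishesOn f I) :
    ∀ᶠ a in 𝓝 (0 : Fin n → ℂ), (∀ i, i ∈ I ↔ a i ≠ 0) →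
      ∀ b : ℂ, b ≠ 0 → ∀ N ∈ 𝓝 a, ∃ z ∈ N, ∃ s : ℝ, 0 < s ∧ value f z = s * b := by
  classical
  obtain ⟨p, hpI, hgen⟩ := exists_generic_weight f.support I
  set P : Fin n → ℝ := fun i => (p i : ℝ) with hPdef
  have hP : ∀ i, 0 ≤ P i := fun i => Nat.cast_nonneg _
  set Δ := faceOfWeight f P with hΔ
  obtain ⟨m₀, hm₀, hm₀Δ⟩ := exists_totalExponent_mem_faceOfWeight hf hP
  set d := weightedDegree p m₀ with hd
  have hmin : ∀ m ∈ f.support, d ≤ weightedDegree p m := by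
    intro m hm
    have := (totalExponent_mem_faceOfWeight_iff hP hm₀).1 hm₀Δ m hm
    rw [weightFunction_natCast, weightFunction_natCast] at this
    exact_mod_cast this
  have hΔiff : ∀ m ∈ f.support, totalExponent m ∈ Δ ↔ weightedDegree p m = d := by
    intro m hm
    rw [totalExponent_mem_faceOfWeight_iff hP hm]
    simp only [weightFunction_natCast, hPdef, Nat.cast_le]
    exact ⟨fun h => le_antisymm (h m₀ hm₀) (hmin m hm), fun h m' hm' => h ▸ hmin m' hm'⟩
  have hd0 : d ≠ 0 := by
    obtain ⟨i, hi, hmi⟩ := exists_totalExponent_ne_zero hv hm₀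
    intro h
    rw [hd, weightedDegree, Finset.sum_eq_zero_iff] at h
    rcases mul_eq_zero.1 (h i (Finset.mem_univ i)) with h1 | h1
    · exact hi ((hpI i).2 h1)
    · rw [totalExponent] at hmi
      exact hmi (by exact_mod_cast h1)
  filter_upwards [eventually_not_isCriticalPoint hf hnd htame hv hP fun i => by
    rw [hpI, hPdef, Nat.cast_eq_zero]] with a ha haI b hb N hN
  set u : {i // i ∈ I} → ℂ := fun j => a j with hu
  have hreg := ha fun i hi => (haI i).1 hi
  simp only [value_faceFunction] at hreg
  set S := f.support.filter fun m => totalExponent m ∈ Δ with hSdef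
  have hS : ∀ m ∈ S, m ∈ f.support ∧ weightedDegree p m = d := by
    intro m hm
    obtain ⟨h1, h2⟩ := Finset.mem_filter.1 hm
    exact ⟨h1, (hΔiff m h1).1 h2⟩
  obtain ⟨w₀, hw₀, hGw₀⟩ := exists_eq_of_not_isCriticalPoint f.coeff hd0
    (fun i hi => (hpI i).1 hi) (fun m hm => (hS m hm).2)
    (fun m hm => hgen m (hS m hm).1 m₀ hm₀ (hS m hm).2) u hreg hb
  have hsurj := not_not.1 (hreg w₀ hw₀)
  set G : ({i // i ∉ I} → ℂ) → ℂ := fun w => ∑ m ∈ S, f.coeff m * mixedMonomial m (glue u w)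
    with hG
  -- `F` is `f(t^p · (u, w))` divided by `t^d`, extended over `t = 0`, where it equals `G`. The
  -- truncated subtraction is exact since `d` is the minimal degree.
  let F : ℝ × ({i // i ∉ I} → ℂ) → ℂ := fun q => ∑ m ∈ f.support,
    f.coeff m * ((q.1 : ℂ) ^ (weightedDegree p m - d) * mixedMonomial m (glue u q.2))
  have hFc : ContDiff ℝ 1 F := by
    refine ContDiff.sum fun m _ => contDiff_const.mul (ContDiff.mul ?_ ?_)
    · exact (Complex.ofRealCLM.contDiff.comp contDiff_fst).pow _
    · exact (contDiff_mixedMonomial m).comp ((contDiff_glue u).comp contDiff_snd)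
  have hF0 : ∀ w, F (0, w) = G w := by
    intro w
    simp only [F, hG, hSdef, Finset.sum_filter]
    refine Finset.sum_congr rfl fun m hm => ?_
    split_ifs with h
    · rw [(hΔiff m hm).1 h]
      simp
    · have h1 : weightedDegree p m - d ≠ 0 := by
        have := hmin m hm
        have h2 : weightedDegree p m ≠ d := fun h' => h ((hΔiff m hm).2 h')
        omega
      simp [h1]
  have hFs := hFc.contDiffAt.hasStrictFDerivAt (x := ((0 : ℝ), w₀)) (by simp)
  have hGF : ∀ v, fderiv ℝ G w₀ v = fderiv ℝ F (0, w₀) (0, v) := by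
    intro v
    have h1 := hFs.hasFDerivAt.comp w₀ (hasFDerivAt_prodMk_right (0 : ℝ) w₀)
    have h2 : G = F ∘ fun w => ((0 : ℝ), w) := funext fun w => (hF0 w).symm
    rw [h2, h1.fderiv]
    rfl
  -- Regularity of `G` at `w₀` makes `(t, w) ↦ (t, F(t, w))` a submersion at `(0, w₀)`, hence
  -- locally onto: `F(t, w) = b` is solvable near `w₀` for each small `t`.
  have hΦ := (hasStrictFDerivAt_fst (𝕜 := ℝ) (p := ((0 : ℝ), w₀))).prodMk hFs
  have hΦmap := hΦ.map_nhds_eq_of_surj (LinearMap.range_eq_top.2 fun q => by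
    obtain ⟨v, hv⟩ := hsurj (q.2 - fderiv ℝ F (0, w₀) (q.1, 0))
    refine ⟨(q.1, v), Prod.ext rfl ?_⟩
    rw [hGF] at hv
    have h1 : fderiv ℝ F (0, w₀) (q.1, v) =
        fderiv ℝ F (0, w₀) (q.1, 0) + fderiv ℝ F (0, w₀) (0, v) := by
      rw [← map_add]
      simp
    change fderiv ℝ F (0, w₀) (q.1, v) = q.2
    rw [h1, hv]
    ring)
  let Ψ : ℝ × ({i // i ∉ I} → ℂ) → Fin n → ℂ := fun q =>
    (fun i => (q.1 : ℂ) ^ p i) * glue u q.2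
  have hΨc : Continuous Ψ := by
    have := (contDiff_glue u).continuous
    have h2 : Continuous fun q : ℝ × ({i // i ∉ I} → ℂ) => (fun i => (q.1 : ℂ) ^ p i : Fin n → ℂ) := by
      fun_prop
    exact h2.mul (this.comp continuous_snd)
  have hΨ0 : Ψ (0, w₀) = a := by
    ext i
    by_cases hi : i ∈ I
    · simp [Ψ, (hpI i).1 hi, glue, hi, hu]
    · have h1 : p i ≠ 0 := fun h => hi ((hpI i).2 h)
      have h2 : a i = 0 := by
        by_contra h
        exact hi ((haI i).2 h)
      simp [Ψ, h1, h2]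
  have hN' : Ψ ⁻¹' N ∈ 𝓝 ((0 : ℝ), w₀) := hΨc.continuousAt.preimage_mem_nhds (by rwa [hΨ0])
  have himg := image_mem_map (m := fun q : ℝ × ({i // i ∉ I} → ℂ) => (q.1, F q)) hN'
  rw [hΦmap, hF0, show G w₀ = b from hGw₀] at himg
  have hlim : Tendsto (fun t : ℝ => (t, b)) (𝓝[>] 0) (𝓝 (0, b)) :=
    ((Continuous.prodMk_left b).tendsto 0).mono_left nhdsWithin_le_nhds
  obtain ⟨t, ⟨⟨t', w⟩, hqN, hq⟩, ht⟩ := ((hlim.eventually himg).and self_mem_nhdsWithin).exists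
  have ht' : (0 : ℝ) < t := ht
  obtain ⟨rfl, hFb⟩ := Prod.mk.inj hq
  refine ⟨Ψ (t', w), hqN, t' ^ d, pow_pos ht' d, ?_⟩
  rw [value_eq_sum, ← hFb, Finset.mul_sum]
  refine Finset.sum_congr rfl fun m hm => ?_
  simp only [Ψ]
  rw [mixedMonomial_mul, mixedMonomial_natPow]
  have : (t' : ℂ) ^ weightedDegree p m = (t' : ℂ) ^ d * (t' : ℂ) ^ (weightedDegree p m - d) := by
    rw [← pow_add, Nat.add_sub_cancel' (hmin m hm)]
  rw [this]
  push_cast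
  ring

/-! ### The stable boundary property -/

/-- There are finitely many possible supports `I`, so the neighbourhoods obtained for each can be
intersected. -/
theorem eventually_exists_value_eq_of_value_eq_zero {n : ℕ} {f : MixedPolynomial n} (hf : f ≠ 0)
    (hnd : ∀ Δ, IsCompactFace f Δ → NoCriticalPointOnTorus (faceFunction f Δ))
    (htame : LocallyTame f) :
    ∀ᶠ a in 𝓝 (0 : Fin n → ℂ), value f a = 0 →
      ∀ b : ℂ, b ≠ 0 → ∀ N ∈ 𝓝 a, ∃ z ∈ N, ∃ s : ℝ, 0 < s ∧ value f z = s * b := by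
  classical
  have hI : ∀ I : Finset (Fin n), ∀ᶠ a in 𝓝 (0 : Fin n → ℂ), (∀ i, i ∈ I ↔ a i ≠ 0) →
      value f a = 0 →
      ∀ b : ℂ, b ≠ 0 → ∀ N ∈ 𝓝 a, ∃ z ∈ N, ∃ s : ℝ, 0 < s ∧ value f z = s * b := by
    intro I
    by_cases hv : VanishesOn f I
    · filter_upwards [eventually_exists_value_eq hf hnd htame hv] with a ha haI _
      exact ha haI
    rcases I.eq_empty_or_nonempty with rfl | hne
    -- Here `a = 0`, and `f(0) = 0` would mean that `f` vanishes on `ℂ^∅`.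
    · refine Eventually.of_forall fun a ha h0 => absurd (fun z hz => ?_) hv
      have h1 : z = a := by
        ext i
        have h2 : a i = 0 := by simpa using ha i
        rw [hz i (by simp), h2]
      rw [h1, h0]
    · filter_upwards [eventually_surjective_fderiv hf hnd hne hv] with a ha haI h0 b hb N hN
      have hs := (contDiff_value f).contDiffAt.hasStrictFDerivAt (x := a) (by simp)
      have himg := image_mem_map (m := value f) hN
      rw [hs.map_nhds_eq_of_surj (LinearMap.range_eq_top.2 (ha haI)), h0] at himg
      have hcont : Continuous fun s : ℝ => (s : ℂ) * b := by fun_prop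
      have hlim : Tendsto (fun s : ℝ => (s : ℂ) * b) (𝓝[>] 0) (𝓝 0) := by
        simpa using (hcont.tendsto 0).mono_left nhdsWithin_le_nhds
      obtain ⟨s, ⟨z, hz, hzs⟩, hs0⟩ := ((hlim.eventually himg).and self_mem_nhdsWithin).exists
      exact ⟨z, hz, s, hs0, hzs⟩
  filter_upwards [eventually_all.2 hI] with a ha
  exact ha (Finset.univ.filter fun i => a i ≠ 0) (by simp)

end MixedMilnor

theorem mainTheorem5 {n : ℕ} (f : MixedMilnor.MixedPolynomial n) (hf : f ≠ 0)
    (hnd : MixedMilnor.StronglyNondegenerate f) (htame : MixedMilnor.LocallyTame f) :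
    ∃ r₀ : ℝ, 0 < r₀ ∧ ∀ r : ℝ, 0 < r → r ≤ r₀ → MixedMilnor.StableBoundary f r := by
  have hcont : Continuous (fun z : EuclideanSpace ℂ (Fin n) => (fun i => z i : Fin n → ℂ)) := by
    fun_prop
  have hev := (hcont.tendsto 0).eventually
    (MixedMilnor.eventually_exists_value_eq_of_value_eq_zero hf hnd.1 htame)
  obtain ⟨r₀, hr₀, hball⟩ := Metric.eventually_nhds_iff_ball.1 hev
  refine ⟨r₀, hr₀, fun r _ hr θ z₀ ⟨hz₀V, hz₀r⟩ => mem_closure_iff_nhds.2 fun N hN => ?_⟩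
  have hcont' : Continuous (fun z : Fin n → ℂ => (WithLp.toLp 2 z : EuclideanSpace ℂ (Fin n))) :=
    PiLp.continuous_toLp 2 _
  have hpre := hcont'.continuousAt.preimage_mem_nhds (x := fun i => z₀ i)
    (Filter.inter_mem hN (Metric.isOpen_ball.mem_nhds hz₀r))
  obtain ⟨z, ⟨hzN, hzr⟩, s, hs, hzs⟩ := hball z₀ (Metric.ball_subset_ball hr hz₀r) hz₀V
    (Complex.exp (θ * Complex.I)) (Complex.exp_ne_zero _) _ hpre
  have hs' : (s : ℂ) ≠ 0 := by exact_mod_cast hs.ne'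
  have hval : MixedMilnor.value f
      (fun i => (WithLp.toLp 2 z : EuclideanSpace ℂ (Fin n)) i) =
      s * Complex.exp (θ * Complex.I) := hzs
  refine ⟨WithLp.toLp 2 z, hzN, ⟨hzr, fun h => ?_⟩, ?_⟩
  · rw [MixedMilnor.zeroSet, Set.mem_ofPred_eq, hval] at h
    exact mul_ne_zero hs' (Complex.exp_ne_zero _) h
  · rw [hval, norm_mul, Complex.norm_exp_ofReal_mul_I, Complex.norm_real,
      Real.norm_of_nonneg hs.le, mul_one, mul_div_cancel_left₀ _ hs']
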